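/- Let $m\ge 1$ and let $\omega$ be a continuous nondecreasing function on $[0,+\infty)$ with $\omega(0)=0$; put $\chi(\delta)=\delta\,\omega(\delta)$. For a domain (nonempty open connected set) $V\subseteq\mathbb R^m$, let $C^{1,\omega}(V)$ be the class of functions $f$ on $V$ whose first order partial derivatives $g=\partial f/\partial t_j$, $j=1,\dots,m$, all exist on $V$ and satisfy $$\sup_{t_1,t_2\in V,\ |t_1-t_2|\le\delta}|g(t_1)-g(t_2)|=O(\omega(\delta)),\qquad \delta\to+0.$$ For $1\le p\le 2$ let $A_p(\mathbb R^m)$ be the space of tempered distributions $F$ on $\mathbb R^m$ whose Fourier transform $\widehat F$ (normalized by $\widehat F(u)=(2\pi)^{-m}\int_{\mathbb R^m}F(t)e^{-i(u,t)}\,dt$ for $F\in L^1$) belongs to $L^p(\mathbb R^m)$, with the norm $\|F\|_{A_p(\mathbb R^m)}=\big(\int_{\mathbb R^m}|\widehat F(u)|^p\,du\big)^{1/p}$; all such $F$ are functions, and for $p=1$ they are taken to be continuous. For $E\subseteq\mathbb R^m$ let $A_p(\mathbb R^m,E)$ be the space of functions $f$ on $E$ that are restrictions to $E$ of functions $F\in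 A_p(\mathbb R^m)$, with the norm $\|f\|_{A_p(\mathbb R^m,E)}=\inf_{F|_E=f}\|F\|_{A_p(\mathbb R^m)}$. **Theorem.** Let $1\le p<2$, let $V$ be a domain in $\mathbb R^m$, and let $\varphi\in C^{1,\omega}(V)$ be a real function such that the set $\nabla\varphi(V)$ is of positive Lebesgue measure. Then $\chi$ is a bijection of $[0,+\infty)$ onto itself, so that its inverse $\chi^{-1}$ is defined on $[0,+\infty)$, and there is a constant $c>0$, independent of $\lambda$, such that $$\|e^{i\lambda\varphi}\|_{A_p(\mathbb R^m,V)}\ \ge\ c\,\Big(|\lambda|^{1/p}\,\chi^{-1}\Big(\frac1{|\lambda|}\Big)\Big)^m$$ for all those $\lambda\in\mathbb R$, $|\lambda|\ge 1$, for which $e^{i\lambda\varphi}\in A_p(\mathbb R^m,V)$. -/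

import Mathlib

open MeasureTheory Set Filter Topology
open scoped SchwartzMap ENNReal NNReal FourierTransform

namespace BeurlingHelson

/-! ### The Fourier transform with the normalization `(2π)⁻ᵐ ∫ f(t) e^{-i(u,t)} dt` -/

/-- The Euclidean space `ℝᵐ`. -/
abbrev Rm (m : ℕ) := EuclideanSpace ℝ (Fin m)

/-- The dilation `u ↦ u / (2π)` of `ℝᵐ`. -/
noncomputable def dilation (m : ℕ) : Rm m ≃L[ℝ] Rm m :=
  ContinuousLinearEquiv.smulLeft (Units.mk0 ((2 * Real.pi)⁻¹ : ℝ) (by positivity))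

/-- The Fourier transform `ψ̂(u) = (2π)⁻ᵐ ∫ ψ(t) e^{-i(u,t)} dt` as a continuous linear operator on
the Schwartz space. It is obtained from Mathlib's `𝓕 ψ (v) = ∫ ψ(t) e^{-2πi(v,t)} dt` by rescaling,
see `schwartzFourier_apply`. -/
noncomputable def schwartzFourier (m : ℕ) : 𝓢(Rm m, ℂ) →L[ℂ] 𝓢(Rm m, ℂ) :=
  (((2 * Real.pi : ℂ) ^ m)⁻¹) •
    ((SchwartzMap.compCLMOfContinuousLinearEquiv ℂ (dilation m)).comp
      (FourierTransform.fourierCLM ℂ 𝓢(Rm m, ℂ)))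

theorem schwartzFourier_apply (m : ℕ) (ψ : 𝓢(Rm m, ℂ)) (u : Rm m) :
    schwartzFourier m ψ u =
      ((2 * Real.pi : ℂ) ^ m)⁻¹ *
        ∫ t : Rm m, ψ t * Complex.exp (-Complex.I * ((inner ℝ u t : ℝ) : ℂ)) := by
  have hd : dilation m u = (2 * Real.pi)⁻¹ • u := rfl
  have h : schwartzFourier m ψ u =
      ((2 * Real.pi : ℂ) ^ m)⁻¹ * 𝓕 (ψ : Rm m → ℂ) (dilation m u) := by
    rw [← SchwartzMap.fourier_coe]; rfl
  rw [h, hd, Real.fourier_eq']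
  congr 1
  refine integral_congr_ae (Eventually.of_forall fun t => ?_)
  have hπ : (Real.pi : ℂ) ≠ 0 := by exact_mod_cast Real.pi_ne_zero
  simp only [inner_smul_right, real_inner_comm t u, smul_eq_mul]
  rw [mul_comm]
  congr 2
  push_cast
  field_simp

/-- The Fourier transform of a tempered distribution, by duality: `⟨T̂, ψ⟩ = ⟨T, ψ̂⟩`. -/
noncomputable def distFourier {m : ℕ} (T : 𝓢'(Rm m, ℂ)) : 𝓢'(Rm m, ℂ) :=
  PointwiseConvergenceCLM.precomp ℂ (schwartzFourier m) T

/-- The tempered distribution `T` is the function `F`: `⟨T, ψ⟩ = ∫ ψ(t) F(t) dt`, with absolutely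
convergent integral, for all Schwartz functions `ψ`. -/
def IsFunction {m : ℕ} (T : 𝓢'(Rm m, ℂ)) (F : Rm m → ℂ) : Prop :=
  ∀ ψ : 𝓢(Rm m, ℂ), Integrable (fun t => ψ t * F t) ∧ T ψ = ∫ t, ψ t * F t

/-- The function `F` is a tempered distribution whose Fourier transform is the function `h`. -/
def HasFourierFunction {m : ℕ} (F h : Rm m → ℂ) : Prop :=
  ∃ T : 𝓢'(Rm m, ℂ), IsFunction T F ∧ IsFunction (distFourier T) h

open Classical in
/-- The Fourier transform `F̂` of a function `F` on `ℝᵐ`, in the sense of tempered distributions,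
when it is a function (the zero function by convention otherwise). It is determined by `F` up to
equality almost everywhere. -/
noncomputable def hat {m : ℕ} (F : Rm m → ℂ) : Rm m → ℂ :=
  if H : ∃ h, HasFourierFunction F h then H.choose else 0

/-! ### The spaces `A_p` -/

/-- `A_p(ℝᵐ)`, `1 ≤ p ≤ 2`: the tempered distributions with Fourier transform in `Lᵖ(ℝᵐ)`; all of
them are functions on `ℝᵐ`, and for `p = 1` they are taken to be continuous. -/
def Ap (m : ℕ) (p : ℝ) : Set (Rm m → ℂ) :=
  {F | (∃ h, HasFourierFunction F h) ∧ MemLp (hat F) (ENNReal.ofReal p) volume ∧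
    (p = 1 → Continuous F)}

/-- The norm `‖F‖_{A_p(ℝᵐ)} = (∫ |F̂(u)|ᵖ du)^{1/p}`. -/
noncomputable def apNorm {m : ℕ} (p : ℝ) (F : Rm m → ℂ) : ℝ :=
  (∫ u, ‖hat F u‖ ^ p) ^ (1 / p)

/-- `A_p(ℝᵐ, E)`: the functions on `E` that have an extension in `A_p(ℝᵐ)`. Only the values of `f`
on `E` matter. -/
def ApOn {m : ℕ} (p : ℝ) (E : Set (Rm m)) : Set (Rm m → ℂ) :=
  {f | ∃ F ∈ Ap m p, EqOn F f E}

/-- The quotient norm `‖f‖_{A_p(ℝᵐ, E)} = inf {‖F‖_{A_p(ℝᵐ)} : F ∈ A_p(ℝᵐ), F|_E = f}`. -/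
noncomputable def apNormOn {m : ℕ} (p : ℝ) (E : Set (Rm m)) (f : Rm m → ℂ) : ℝ :=
  sInf (apNorm p '' {F | F ∈ Ap m p ∧ EqOn F f E})

/-! ### The classes `C^{1,ω}(V)` -/

/-- The modulus of continuity `ω(V, g, δ) = sup {|g(t₁) - g(t₂)| : t₁, t₂ ∈ V, |t₁ - t₂| ≤ δ}`,
with values in `[0, ∞]`. -/
noncomputable def modulus {m : ℕ} (V : Set (Rm m)) (g : Rm m → ℝ) (δ : ℝ) : ℝ≥0∞ :=
  ⨆ t₁ ∈ V, ⨆ t₂ ∈ V, ⨆ _ : ‖t₁ - t₂‖ ≤ δ, ENNReal.ofReal |g t₁ - g t₂|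

/-- `g ∈ Lip_ω(V)`: `ω(V, g, δ) = O(ω(δ))` as `δ → +0`. -/
def LipOmega {m : ℕ} (ω : ℝ → ℝ) (V : Set (Rm m)) (g : Rm m → ℝ) : Prop :=
  ∃ C : ℝ, ∀ᶠ δ in 𝓝[>] (0 : ℝ), modulus V g δ ≤ ENNReal.ofReal (C * ω δ)

/-- The partial derivative `∂φ/∂t_j`. -/
noncomputable def partialDeriv {m : ℕ} (φ : Rm m → ℝ) (j : Fin m) (t : Rm m) : ℝ :=
  lineDeriv ℝ φ t (EuclideanSpace.single j 1)

/-- The gradient, i.e. the vector of the first order partial derivatives. -/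
noncomputable def grad {m : ℕ} (φ : Rm m → ℝ) (t : Rm m) : Rm m :=
  WithLp.toLp 2 fun j => partialDeriv φ j t

/-- `φ ∈ C^{1,ω}(V)` for a real function `φ` on the open set `V`: all first order partial
derivatives exist on `V` and belong to `Lip_ω(V)`. Only the values of `φ` on `V` matter. -/
def C1Omega {m : ℕ} (ω : ℝ → ℝ) (V : Set (Rm m)) (φ : Rm m → ℝ) : Prop :=
  ∀ j : Fin m, (∀ t ∈ V, LineDifferentiableAt ℝ φ t (EuclideanSpace.single j 1)) ∧
    LipOmega ω V (partialDeriv φ j)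

/-! ### The function `χ` and its inverse -/

/-- `χ(δ) = δ ω(δ)`. -/
def chi (ω : ℝ → ℝ) (δ : ℝ) : ℝ := δ * ω δ

/-- The inverse of `χ : [0, ∞) → [0, ∞)`. -/
noncomputable def chiInv (ω : ℝ → ℝ) : ℝ → ℝ := Function.invFunOn (chi ω) (Ici 0)

end BeurlingHelson

namespace BeurlingHelson


/-! On a ball of radius `δ` about `t₀` the phase `λφ` differs from its linear part by at most `|λ| m
C δ ω(δ)`. If this is at most `1/2`, an extension `F` of `e^{iλφ}` looks there like a plane wave of
frequency `u = λ∇φ(t₀)`. Its integral against a bump of width `δ` modulated by `e^{-i(u,t)}` is then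
at least a constant times `δ^m`.

By the multiplication formula this integral equals `∫ ψ F̂`, where `|ψ|` is an `L¹`-normalized
dilate of a fixed profile, centred at `u`. So the convolution of `|F̂|` with a kernel of `L¹` norm
independent of `δ` is at least of order `δ^m` for every `u` in `λ∇φ(V')`, where `V'` consists of the
points whose closed ball of a fixed radius lies in `V`. This set of frequencies has measure `|λ|^m
|∇φ(V')|`, and Young's inequality `L¹ * L^p ⊆ L^p` gives `‖F̂‖_p ≥ c δ^m |λ|^{m/p}`
(`exists_le_apNorm`). The choice `δ = s χ⁻¹(1/|λ|)` with a small fixed `s` keeps the phase error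
below `1/2`.

The bijectivity of `χ` rests on `ω > 0` off `0`: otherwise `∇φ` would be locally constant, hence
constant on the connected set `V`, with a null image. -/

/-! ### Fourier inversion and wave packets -/

/-- The inverse of `schwartzFourier`. -/
noncomputable def schwartzFourierInv (m : ℕ) (ψ : 𝓢(Rm m, ℂ)) : 𝓢(Rm m, ℂ) :=
  ((2 * Real.pi : ℂ) ^ m) •
    𝓕⁻ (SchwartzMap.compCLMOfContinuousLinearEquiv ℂ (dilation m).symm ψ)

theorem schwartzFourier_schwartzFourierInv (m : ℕ) (ψ : 𝓢(Rm m, ℂ)) :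
    schwartzFourier m (schwartzFourierInv m ψ) = ψ := by
  have hπ : ((2 * Real.pi : ℂ) ^ m) ≠ 0 := by
    exact pow_ne_zero _ (mul_ne_zero two_ne_zero (by exact_mod_cast Real.pi_ne_zero))
  unfold schwartzFourier schwartzFourierInv
  rw [map_smul, smul_apply, smul_smul, mul_inv_cancel₀ hπ, one_smul,
    ContinuousLinearMap.comp_apply]
  ext x
  simp

theorem schwartzFourierInv_apply (m : ℕ) (ψ : 𝓢(Rm m, ℂ)) (v : Rm m) :
    schwartzFourierInv m ψ v =
      ∫ t : Rm m, Complex.exp (Complex.I * ((inner ℝ v t : ℝ) : ℂ)) * ψ t := by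
  have hs : ∀ x : Rm m, (dilation m).symm x = (2 * Real.pi) • x := by
    intro x
    rw [ContinuousLinearEquiv.symm_apply_eq]
    change x = (2 * Real.pi)⁻¹ • ((2 * Real.pi) • x)
    rw [smul_smul, inv_mul_cancel₀ (by positivity), one_smul]
  have h := Measure.integral_comp_smul (volume : Measure (Rm m))
    (fun t : Rm m => Complex.exp (Complex.I * ((inner ℝ v t : ℝ) : ℂ)) * ψ t) (2 * Real.pi)
  have hπ : (0 : ℝ) < 2 * Real.pi := by positivity
  rw [finrank_euclideanSpace, Fintype.card_fin, abs_of_pos (by positivity)] at h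
  have h2 : (∫ t : Rm m, Complex.exp (Complex.I * ((inner ℝ v t : ℝ) : ℂ)) * ψ t) =
      ((2 * Real.pi) ^ m : ℝ) • ∫ x : Rm m,
        Complex.exp (Complex.I * ((inner ℝ v ((2 * Real.pi) • x) : ℝ) : ℂ)) *
          ψ ((2 * Real.pi) • x) := by
    rw [h, smul_smul, mul_inv_cancel₀ (by positivity), one_smul]
  rw [h2]
  unfold schwartzFourierInv
  rw [smul_apply, SchwartzMap.fourierInv_coe, Real.fourierInv_eq']
  rw [Complex.real_smul, smul_eq_mul]
  congr 1
  · push_cast; rfl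
  refine integral_congr_ae (Eventually.of_forall fun x => ?_)
  simp only [SchwartzMap.compCLMOfContinuousLinearEquiv_apply, Function.comp_apply, hs, smul_eq_mul,
    inner_smul_right, real_inner_comm v x]
  congr 2
  ring

/-- A modulated, translated and dilated bump is the Fourier transform of a Schwartz function whose
absolute value is a translated and dilated copy of a fixed profile. -/
theorem exists_wavePacket {m : ℕ} (η : 𝓢(Rm m, ℂ)) (hη : HasCompactSupport η) {δ : ℝ} (hδ : 0 < δ)
    (t₀ u : Rm m) :
    ∃ ψ : 𝓢(Rm m, ℂ),
      (∀ t, schwartzFourier m ψ t =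
        Complex.exp (-Complex.I * ((inner ℝ u (t - t₀) : ℝ) : ℂ)) * η (δ⁻¹ • (t - t₀))) ∧
      ∀ v, ‖ψ v‖ = δ ^ m * ‖schwartzFourierInv m η (δ • (v - u))‖ := by
  have hsmooth : ContDiff ℝ (⊤ : ℕ∞) (fun t : Rm m =>
      Complex.exp (-Complex.I * ((inner ℝ u (t - t₀) : ℝ) : ℂ)) * η (δ⁻¹ • (t - t₀))) := by
    have h1 : ContDiff ℝ (⊤ : ℕ∞) (fun t : Rm m => ((inner ℝ u (t - t₀) : ℝ) : ℂ)) :=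
      Complex.ofRealCLM.contDiff.comp (contDiff_const.inner ℝ (contDiff_id.sub contDiff_const))
    have h2 : ContDiff ℝ (⊤ : ℕ∞) (fun t : Rm m => η (δ⁻¹ • (t - t₀))) :=
      (η.smooth _).comp ((contDiff_id.sub contDiff_const).const_smul δ⁻¹)
    exact (contDiff_const.mul h1).cexp.mul h2
  have hcomp : HasCompactSupport (fun t : Rm m =>
      Complex.exp (-Complex.I * ((inner ℝ u (t - t₀) : ℝ) : ℂ)) * η (δ⁻¹ • (t - t₀))) := by
    apply HasCompactSupport.mul_left
    have := hη.comp_homeomorph ((Homeomorph.subRight t₀).trans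
      (Homeomorph.smulOfNeZero δ⁻¹ (inv_ne_zero hδ.ne')))
    exact this
  refine ⟨schwartzFourierInv m (hcomp.toSchwartzMap hsmooth), fun t => ?_, fun v => ?_⟩
  · rw [schwartzFourier_schwartzFourierInv]; rfl
  rw [schwartzFourierInv_apply, schwartzFourierInv_apply]
  -- Centring the phase at `t₀` splits off the unimodular factor `e^{i(v,t₀)}`, which disappears in
  -- the norm.
  have e1 : (∫ t : Rm m, Complex.exp (Complex.I * ((inner ℝ v t : ℝ) : ℂ)) *
      (hcomp.toSchwartzMap hsmooth) t) =
      Complex.exp (Complex.I * ((inner ℝ v t₀ : ℝ) : ℂ)) * ∫ t : Rm m,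
        (fun s : Rm m => Complex.exp (Complex.I * ((inner ℝ (δ • (v - u)) (δ⁻¹ • s) : ℝ) : ℂ)) *
          η (δ⁻¹ • s)) (t - t₀) := by
    rw [← integral_const_mul]
    refine integral_congr_ae (Eventually.of_forall fun t => ?_)
    change Complex.exp (Complex.I * ((inner ℝ v t : ℝ) : ℂ)) *
        (Complex.exp (-Complex.I * ((inner ℝ u (t - t₀) : ℝ) : ℂ)) * η (δ⁻¹ • (t - t₀))) =
      Complex.exp (Complex.I * ((inner ℝ v t₀ : ℝ) : ℂ)) *
        (Complex.exp (Complex.I * ((inner ℝ (δ • (v - u)) (δ⁻¹ • (t - t₀)) : ℝ) : ℂ)) *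
          η (δ⁻¹ • (t - t₀)))
    rw [← mul_assoc, ← mul_assoc, ← Complex.exp_add, ← Complex.exp_add]
    congr 2
    simp only [inner_smul_left, inner_smul_right, inner_sub_left, inner_sub_right]
    have hδ' : (δ : ℂ) ≠ 0 := by exact_mod_cast hδ.ne'
    push_cast
    simp
    field_simp
    ring
  rw [e1, integral_sub_right_eq_self (fun s : Rm m =>
      Complex.exp (Complex.I * ((inner ℝ (δ • (v - u)) (δ⁻¹ • s) : ℝ) : ℂ)) * η (δ⁻¹ • s)),
    Measure.integral_comp_smul (volume : Measure (Rm m))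
    (fun s : Rm m => Complex.exp (Complex.I * ((inner ℝ (δ • (v - u)) s : ℝ) : ℂ)) * η s) δ⁻¹]
  rw [finrank_euclideanSpace, Fintype.card_fin, abs_of_pos (by positivity), norm_mul, norm_smul,
    Complex.norm_exp_I_mul_ofReal, one_mul, inv_pow, inv_inv, Real.norm_of_nonneg (by positivity)]


/-! ### Young's inequality for `L¹ * L^p` -/

/-- Monotonicity in the exponent of the `L^p` norms for the measure `k dμ`, whose total mass is `∫
k`. -/
theorem lintegral_mul_enorm_rpow_le {α : Type*} [MeasurableSpace α] {μ : Measure α} {p : ℝ}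
    (hp : 1 ≤ p) {k : α → ℝ≥0∞} (hk : Measurable k) {h : α → ℂ} (hh : AEStronglyMeasurable h μ) :
    (∫⁻ v, k v * ‖h v‖ₑ ∂μ) ^ p ≤ (∫⁻ v, k v ∂μ) ^ (p - 1) * ∫⁻ v, k v * ‖h v‖ₑ ^ p ∂μ := by
  have hp0 : 0 < p := by linarith
  have hac := withDensity_absolutelyContinuous μ k
  have hh' := hh.mono_ac hac
  have key := eLpNorm_le_eLpNorm_mul_rpow_measure_univ (p := 1) (q := ENNReal.ofReal p)
    (by simpa using hp) hh'
  rw [eLpNorm_one_eq_lintegral_enorm, eLpNorm_eq_lintegral_rpow_enorm_toReal (by simpa using hp0)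
    ENNReal.ofReal_ne_top, ENNReal.toReal_ofReal hp0.le, ENNReal.toReal_one,
    withDensity_apply _ MeasurableSet.univ, Measure.restrict_univ,
    lintegral_withDensity_eq_lintegral_mul₀ hk.aemeasurable hh.enorm,
    lintegral_withDensity_eq_lintegral_mul₀ hk.aemeasurable (hh.enorm.pow_const p)] at key
  have := ENNReal.rpow_le_rpow key hp0.le
  rw [ENNReal.mul_rpow_of_nonneg _ _ hp0.le, ← ENNReal.rpow_mul, ← ENNReal.rpow_mul,
    one_div_mul_cancel hp0.ne', ENNReal.rpow_one] at this
  have e : (1 / 1 - 1 / p) * p = p - 1 := by field_simp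
  rw [e, mul_comm] at this
  simpa only [Pi.mul_apply, mul_comm] using this

/-- If the convolution of `k` with `|h|` is at least `a` on `S`, then
`aᵖ |S| ≤ ‖k‖₁ᵖ ‖h‖ₚᵖ`. -/
theorem rpow_mul_measure_le_of_le_lintegral {m : ℕ} {p : ℝ} (hp : 1 ≤ p) {k : Rm m → ℝ≥0∞}
    (hk : Measurable k) {h : Rm m → ℂ} (hh : AEStronglyMeasurable h volume) {S : Set (Rm m)}
    {a : ℝ≥0∞} (ha : ∀ u ∈ S, a ≤ ∫⁻ v, k (v - u) * ‖h v‖ₑ) :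
    a ^ p * volume S ≤ (∫⁻ v, k v) ^ p * ∫⁻ v, ‖h v‖ₑ ^ p := by
  have hp0 : 0 < p := by linarith
  set M := ∫⁻ v, k v with hM
  have hmeas : AEMeasurable (fun z : Rm m × Rm m => k (z.2 - z.1) * ‖h z.2‖ₑ ^ p)
      (volume.prod volume) :=
    (hk.comp (measurable_snd.sub measurable_fst)).aemeasurable.mul
      ((hh.enorm.pow_const p).comp_quasiMeasurePreserving Measure.quasiMeasurePreserving_snd)
  -- `S` need not be measurable, so Chebyshev's inequality is applied to a superlevel set containing
  -- it.
  have hsub : S ⊆ {u | a ^ p ≤ M ^ (p - 1) * ∫⁻ v, k (v - u) * ‖h v‖ₑ ^ p} := by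
    intro u hu
    refine (ENNReal.rpow_le_rpow (ha u hu) hp0.le).trans ?_
    have := lintegral_mul_enorm_rpow_le (μ := volume) hp (k := fun v => k (v - u))
      (hk.comp (measurable_id.sub_const u)) hh
    rwa [lintegral_sub_right_eq_self] at this
  calc a ^ p * volume S ≤ a ^ p * volume {u | a ^ p ≤ M ^ (p - 1) * ∫⁻ v, k (v - u) * ‖h v‖ₑ ^ p} := by
        gcongr
    _ ≤ ∫⁻ u, M ^ (p - 1) * ∫⁻ v, k (v - u) * ‖h v‖ₑ ^ p :=
        mul_meas_ge_le_lintegral₀ (hmeas.lintegral_prod_right'.const_mul _) _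
    _ = M ^ (p - 1) * ∫⁻ u, ∫⁻ v, k (v - u) * ‖h v‖ₑ ^ p :=
        lintegral_const_mul'' _ hmeas.lintegral_prod_right'
    _ = M ^ (p - 1) * ∫⁻ v, ∫⁻ u, k (v - u) * ‖h v‖ₑ ^ p := by
        rw [lintegral_lintegral_swap hmeas]
    _ = M ^ (p - 1) * ∫⁻ v, M * ‖h v‖ₑ ^ p := by
        congr 1
        refine lintegral_congr fun v => ?_
        have hk' : Measurable fun u => k (v - u) := hk.comp (measurable_const.sub measurable_id)
        rw [lintegral_mul_const _ hk', lintegral_sub_left_eq_self]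
    _ = M ^ p * ∫⁻ v, ‖h v‖ₑ ^ p := by
        rw [lintegral_const_mul'' _ (hh.enorm.pow_const p), ← mul_assoc]
        congr 1
        nth_rw 2 [← ENNReal.rpow_one M]
        rw [← ENNReal.rpow_add_of_nonneg _ _ (by linarith) zero_le_one]
        congr 1; ring


/-! ### Taylor estimate from the partial derivatives -/

theorem norm_sub_le_of_abs_le {m : ℕ} {x y z : Rm m} (h : ∀ i, |x i - z i| ≤ |y i - z i|) :
    ‖x - z‖ ≤ ‖y - z‖ := by
  rw [EuclideanSpace.norm_eq, EuclideanSpace.norm_eq]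
  refine Real.sqrt_le_sqrt (Finset.sum_le_sum fun i _ => ?_)
  simp only [PiLp.sub_apply, Real.norm_eq_abs]
  exact pow_le_pow_left₀ (abs_nonneg _) (h i) 2

/-- First order Taylor estimate on a ball, from the oscillation of the partial derivatives. -/
theorem abs_sub_sub_inner_grad_le {m : ℕ} {φ : Rm m → ℝ} {t₀ : Rm m} {δ K : ℝ}
    (hd : ∀ j, ∀ x, ‖x - t₀‖ ≤ δ → LineDifferentiableAt ℝ φ x (EuclideanSpace.single j 1))
    (hK : ∀ j, ∀ x, ‖x - t₀‖ ≤ δ → |partialDeriv φ j x - partialDeriv φ j t₀| ≤ K)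
    {t : Rm m} (ht : ‖t - t₀‖ ≤ δ) :
    |φ t - φ t₀ - inner ℝ (grad φ t₀) (t - t₀)| ≤ m * (K * δ) := by
  have hδ : 0 ≤ δ := (norm_nonneg _).trans ht
  -- Path from `t₀` to `t` changing one coordinate at a time, so that only partial derivatives are
  -- needed. Each coordinate stays between those of `t₀` and `t`, which keeps the path in the ball.
  let pt (s : Finset (Fin m)) : Rm m := WithLp.toLp 2 fun i => if i ∈ s then t i else t₀ i
  have main : ∀ s : Finset (Fin m),
      |φ (pt s) - φ t₀ - ∑ j ∈ s, partialDeriv φ j t₀ * (t j - t₀ j)| ≤ s.card * (K * δ) := by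
    intro s
    induction s using Finset.induction_on with
    | empty =>
      have : pt ∅ = t₀ := by ext i; simp [pt]
      simp [this]
    | insert j s hj ih =>
      have hK0 : 0 ≤ K := (abs_nonneg _).trans (hK j t₀ (by simpa using hδ))
      set y := pt s with hy
      have hyj : y j = t₀ j := by simp [hy, pt, hj]
      set L := t j - t₀ j with hL
      have hend : pt (insert j s) = y + L • EuclideanSpace.single j (1 : ℝ) := by
        ext i
        by_cases hij : i = j
        · subst hij; simp [pt, hy, hj, hL]
        · simp [pt, hy, hij]
      have hmem : ∀ r ∈ uIcc 0 L, ‖y + r • EuclideanSpace.single j (1 : ℝ) - t₀‖ ≤ δ := by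
        intro r hr
        refine (norm_sub_le_of_abs_le (y := t) fun i => ?_).trans ht
        by_cases hij : i = j
        · subst hij
          have : |r| ≤ |L| := by simpa using abs_sub_left_of_mem_uIcc hr
          simpa [hyj] using this
        · by_cases his : i ∈ s <;> simp [hy, pt, hij, his]
      -- With the linear term subtracted, the derivative along the segment is an oscillation of the
      -- partial derivative, bounded by `K`.
      have hder : ∀ r ∈ uIcc 0 L, HasDerivWithinAt
          (fun r : ℝ => φ (y + r • EuclideanSpace.single j (1 : ℝ)) - r * partialDeriv φ j t₀)
          (partialDeriv φ j (y + r • EuclideanSpace.single j (1 : ℝ)) - partialDeriv φ j t₀)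
          (uIcc 0 L) r := by
        intro r hr
        have h1 := (hd j _ (hmem r hr)).hasLineDerivAt
        have h2 : HasDerivAt (fun q : ℝ => φ (y + q • EuclideanSpace.single j (1 : ℝ)))
            (partialDeriv φ j (y + r • EuclideanSpace.single j (1 : ℝ))) r := by
          have h3 : HasDerivAt (fun q : ℝ => φ (y + r • EuclideanSpace.single j (1 : ℝ) +
              q • EuclideanSpace.single j (1 : ℝ)))
              (partialDeriv φ j (y + r • EuclideanSpace.single j (1 : ℝ))) (r - r) := by
            rw [sub_self]; exact h1
          have h4 := h3.comp_sub_const r r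
          refine h4.congr_of_eventuallyEq (Eventually.of_forall fun q => ?_)
          simp only
          congr 1
          rw [add_assoc, ← add_smul]
          congr 2
          ring
        have h5 := h2.sub ((hasDerivAt_id r).mul_const (partialDeriv φ j t₀))
        rw [one_mul] at h5
        exact h5.hasDerivWithinAt
      have hmv := (convex_uIcc (0 : ℝ) L).norm_image_sub_le_of_norm_hasDerivWithin_le hder
        (fun r hr => hK j _ (hmem r hr)) left_mem_uIcc right_mem_uIcc
      have hLδ : |L| ≤ δ := by
        have := hmem L right_mem_uIcc
        refine le_trans ?_ ht
        have h := PiLp.norm_apply_le (p := 2) (t - t₀) j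
        simpa [hL] using h
      simp only [zero_smul, add_zero, zero_mul, sub_zero, Real.norm_eq_abs] at hmv
      rw [← hend] at hmv
      have hstep : |φ (pt (insert j s)) - L * partialDeriv φ j t₀ - φ y| ≤ K * δ :=
        hmv.trans (mul_le_mul_of_nonneg_left hLδ hK0)
      rw [Finset.sum_insert hj, Finset.card_insert_of_notMem hj]
      have e : φ (pt (insert j s)) - φ t₀ - (partialDeriv φ j t₀ * (t j - t₀ j) +
          ∑ j ∈ s, partialDeriv φ j t₀ * (t j - t₀ j)) =
          (φ (pt (insert j s)) - L * partialDeriv φ j t₀ - φ y) +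
          (φ y - φ t₀ - ∑ j ∈ s, partialDeriv φ j t₀ * (t j - t₀ j)) := by
        rw [hL]; ring
      rw [e]
      refine (abs_add_le _ _).trans ?_
      push_cast
      linarith
  have h := main Finset.univ
  have e1 : pt Finset.univ = t := by ext i; simp [pt]
  have e2 : inner ℝ (grad φ t₀) (t - t₀) = ∑ j, partialDeriv φ j t₀ * (t j - t₀ j) := by
    simp [PiLp.inner_apply, grad, mul_comm]
  rw [e2]
  simpa [e1] using h

/-- The Lipschitz condition on the partial derivatives, with one constant for all of them. -/
theorem C1Omega.exists_abs_sub_le {m : ℕ} {ω : ℝ → ℝ} (hω : ∀ δ, 0 ≤ δ → 0 ≤ ω δ) {V : Set (Rm m)}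
    {φ : Rm m → ℝ} (hφ : C1Omega ω V φ) :
    ∃ C : ℝ, 0 < C ∧ ∃ δ₀ : ℝ, 0 < δ₀ ∧ ∀ δ, 0 < δ → δ ≤ δ₀ → ∀ j, ∀ x ∈ V, ∀ y ∈ V,
      ‖x - y‖ ≤ δ → |partialDeriv φ j x - partialDeriv φ j y| ≤ C * ω δ := by
  choose C hC using fun j => (hφ j).2
  have hev : ∀ᶠ δ in 𝓝[>] (0 : ℝ), ∀ j, modulus V (partialDeriv φ j) δ ≤ ENNReal.ofReal (C j * ω δ) :=
    eventually_all.2 hC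
  obtain ⟨δ₀, hδ₀, h⟩ := mem_nhdsGT_iff_exists_Ioc_subset.1 hev
  have hS : 0 ≤ ∑ j, |C j| := Finset.sum_nonneg fun j _ => abs_nonneg _
  refine ⟨∑ j, |C j| + 1, by linarith, δ₀, hδ₀, fun δ hδ hle j x hx y hy hxy => ?_⟩
  have h1 : ENNReal.ofReal |partialDeriv φ j x - partialDeriv φ j y| ≤
      modulus V (partialDeriv φ j) δ := by
    unfold modulus
    exact le_iSup₂_of_le x hx (le_iSup₂_of_le y hy (le_iSup_of_le hxy le_rfl))
  have hω' := hω δ hδ.le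
  have h2 : C j * ω δ ≤ (∑ j, |C j| + 1) * ω δ := by
    refine mul_le_mul_of_nonneg_right ?_ hω'
    have := Finset.single_le_sum (f := fun j => |C j|) (fun i _ => abs_nonneg _) (Finset.mem_univ j)
    have := le_abs_self (C j)
    simp only at *
    linarith
  exact (ENNReal.ofReal_le_ofReal_iff (by positivity)).1
    ((h1.trans (h ⟨hδ, hle⟩ j)).trans (ENNReal.ofReal_le_ofReal h2))

/-! ### Positivity of `ω` and bijectivity of `χ` -/

/-- If `ω` vanishes at a positive point, the gradient is constant. -/
theorem C1Omega.volume_image_grad_eq_zero {m : ℕ} (hm : 1 ≤ m) {ω : ℝ → ℝ}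
    (hmono : MonotoneOn ω (Ici 0)) (h0 : ω 0 = 0) {V : Set (Rm m)} (hconn : IsConnected V)
    {φ : Rm m → ℝ} (hφ : C1Omega ω V φ) {δ : ℝ} (hδ : 0 < δ) (hωδ : ω δ = 0) :
    volume (grad φ '' V) = 0 := by
  have hω : ∀ δ, 0 ≤ δ → 0 ≤ ω δ := fun δ hδ => h0 ▸ hmono (mem_Ici.2 le_rfl) hδ hδ
  obtain ⟨C, -, δ₀, hδ₀, h⟩ := hφ.exists_abs_sub_le hω
  set ε := min δ δ₀ with hε
  have hε0 : 0 < ε := lt_min hδ hδ₀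
  have hωε : ω ε = 0 :=
    le_antisymm (hωδ ▸ hmono hε0.le hδ.le (min_le_left _ _)) (hω _ hε0.le)
  have hloc : ∀ x ∈ V, ∀ y ∈ V, ‖x - y‖ ≤ ε → grad φ x = grad φ y := by
    intro x hx y hy hxy
    ext j
    have := h ε hε0 (min_le_right _ _) j x hx y hy hxy
    rw [hωε, mul_zero] at this
    exact sub_eq_zero.1 (abs_nonpos_iff.1 this)
  have hconst : ∀ x ∈ V, ∀ y ∈ V, grad φ x = grad φ y := by
    intro x hx y hy
    refine hconn.isPreconnected.induction₂ (fun x y => grad φ x = grad φ y) (fun x hx => ?_)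
      (fun x y z _ _ _ h1 h2 => h1.trans h2) (fun x y _ _ h => h.symm) hx hy
    have : Metric.closedBall x ε ∈ 𝓝[V] x :=
      mem_nhdsWithin_of_mem_nhds (Metric.closedBall_mem_nhds x hε0)
    filter_upwards [this, self_mem_nhdsWithin] with y hy hyV
    refine hloc x hx y hyV ?_
    rw [← dist_eq_norm, dist_comm]; exact hy
  -- Points are null sets only in positive dimension.
  have : Nonempty (Fin m) := ⟨⟨0, hm⟩⟩
  obtain ⟨x, hx⟩ := hconn.nonempty
  refine measure_mono_null (t := {grad φ x}) ?_ (measure_singleton _)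
  rintro _ ⟨y, hy, rfl⟩
  exact hconst y hy x hx

theorem bijOn_chi {ω : ℝ → ℝ} (hcont : ContinuousOn ω (Ici 0)) (hmono : MonotoneOn ω (Ici 0))
    (h0 : ω 0 = 0) (hpos : ∀ δ, 0 < δ → 0 < ω δ) :
    BijOn (chi ω) (Ici 0) (Ici 0) ∧ StrictMonoOn (chi ω) (Ici 0) := by
  have hω : ∀ δ, 0 ≤ δ → 0 ≤ ω δ := fun δ hδ => h0 ▸ hmono (mem_Ici.2 le_rfl) hδ hδ
  have hstrict : StrictMonoOn (chi ω) (Ici 0) := by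
    intro a ha b hb hab
    have hb0 : 0 < b := lt_of_le_of_lt ha hab
    calc a * ω a ≤ a * ω b := mul_le_mul_of_nonneg_left (hmono ha hb hab.le) ha
      _ < b * ω b := mul_lt_mul_of_pos_right hab (hpos b hb0)
  refine ⟨⟨fun x hx => mul_nonneg hx (hω x hx), hstrict.injOn, fun y hy => ?_⟩, hstrict⟩
  have h1 := hpos 1 one_pos
  -- Since `ω ≥ ω 1` on `[1, ∞)`, `χ` exceeds `y` at this `R`, and the intermediate value theorem
  -- applies.
  set R := max 1 (y / ω 1) with hR
  have hR1 : 1 ≤ R := le_max_left _ _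
  have hR0 : 0 ≤ R := by linarith
  have hyR : y ≤ chi ω R := calc
    y = y / ω 1 * ω 1 := by field_simp
    _ ≤ R * ω 1 := mul_le_mul_of_nonneg_right (le_max_right _ _) h1.le
    _ ≤ R * ω R := mul_le_mul_of_nonneg_left (hmono (mem_Ici.2 zero_le_one) hR0 hR1) hR0
  have hc : ContinuousOn (chi ω) (Icc 0 R) :=
    (continuousOn_id.mul hcont).mono Icc_subset_Ici_self
  obtain ⟨x, hx, hxy⟩ := intermediate_value_Icc hR0 hc (show y ∈ Icc (chi ω 0) (chi ω R) from
    ⟨by simpa [chi] using hy, hyR⟩)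
  exact ⟨x, hx.1, hxy⟩


/-! ### Lower bounds for `F̂` from wave packets -/

theorem hasFourierFunction_hat {m : ℕ} {F : Rm m → ℂ} (H : ∃ h, HasFourierFunction F h) :
    HasFourierFunction F (hat F) := by
  rw [hat, dif_pos H]
  exact H.choose_spec

/-- The multiplication formula `∫ ψ̂ F = ∫ ψ F̂`. -/
theorem HasFourierFunction.integral_eq {m : ℕ} {F h : Rm m → ℂ} (H : HasFourierFunction F h)
    (ψ : 𝓢(Rm m, ℂ)) :
    Integrable (fun t => schwartzFourier m ψ t * F t) ∧
      ∫ t, schwartzFourier m ψ t * F t = ∫ v, ψ v * h v := by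
  obtain ⟨T, hF, hh⟩ := H
  exact ⟨(hF _).1, (hF _).2.symm.trans (hh ψ).2⟩

/-- Where `F` is `e^{iθ}` with a phase `θ` close to a linear function with gradient `u`, the
convolution of `|F̂|` with the profile of a wave packet is bounded below at `u`. -/
theorem HasFourierFunction.le_lintegral {m : ℕ} {F h : Rm m → ℂ} (H : HasFourierFunction F h)
    {b : Rm m → ℝ} (hb : ∀ t, 0 ≤ b t) (hb1 : ∀ t, 1 < ‖t‖ → b t = 0)
    {η : 𝓢(Rm m, ℂ)} (hη : HasCompactSupport η) (hbη : ∀ t, η t = b t)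
    {δ : ℝ} (hδ : 0 < δ) {t₀ u : Rm m} {θ : Rm m → ℝ}
    (hF : ∀ t, ‖t - t₀‖ ≤ δ → F t = Complex.exp (Complex.I * (θ t : ℝ)))
    (hθ : ∀ t, ‖t - t₀‖ ≤ δ → |θ t - θ t₀ - inner ℝ u (t - t₀)| ≤ 1 / 2) :
    ENNReal.ofReal (δ ^ m * ((1 / 2) * ∫ t, b t)) ≤
      ∫⁻ v, ‖δ ^ m * ‖schwartzFourierInv m η (δ • (v - u))‖‖ₑ * ‖h v‖ₑ := by
  obtain ⟨ψ, hψ, hnorm⟩ := exists_wavePacket η hη hδ t₀ u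
  obtain ⟨hint, heq⟩ := H.integral_eq ψ
  have hbint : Integrable b := by
    have := η.integrable (μ := (volume : Measure (Rm m))) |>.re
    simpa [hbη] using this
  set B : Rm m → ℝ := fun t => b (δ⁻¹ • (t - t₀)) with hB
  have hBint : Integrable B := by
    have h1 : Integrable (fun t => b (δ⁻¹ • t)) := hbint.comp_smul (inv_ne_zero hδ.ne')
    exact h1.comp_sub_right t₀
  have hBval : ∫ t, B t = δ ^ m * ∫ t, b t := by
    rw [hB, integral_sub_right_eq_self (fun t : Rm m => b (δ⁻¹ • t)),
      Measure.integral_comp_smul, finrank_euclideanSpace, Fintype.card_fin,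
      abs_of_pos (by positivity), inv_pow, inv_inv, smul_eq_mul]
  -- Unimodular constant cancelling the phase `θ t₀`, so that the integrand is close to the positive
  -- bump `B`.
  set ζ : ℂ := Complex.exp (Complex.I * ((-θ t₀ : ℝ) : ℂ)) with hζ
  have hpt : ∀ t, ‖ζ * (schwartzFourier m ψ t * F t) - (B t : ℂ)‖ ≤ 1 / 2 * B t := by
    intro t
    rw [hψ, hbη]
    by_cases ht : ‖t - t₀‖ ≤ δ
    · have e : ζ * (Complex.exp (-Complex.I * ((inner ℝ u (t - t₀) : ℝ) : ℂ)) *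
            (b (δ⁻¹ • (t - t₀)) : ℂ) * F t) - (B t : ℂ) =
          (Complex.exp (Complex.I * ((θ t - θ t₀ - inner ℝ u (t - t₀) : ℝ) : ℂ)) - 1) * (B t : ℂ) := by
        have e2 : Complex.exp (Complex.I * ((θ t - θ t₀ - inner ℝ u (t - t₀) : ℝ) : ℂ)) =
            ζ * Complex.exp (-Complex.I * ((inner ℝ u (t - t₀) : ℝ) : ℂ)) *
              Complex.exp (Complex.I * (θ t : ℝ)) := by
          rw [hζ, ← Complex.exp_add, ← Complex.exp_add]
          congr 1
          push_cast
          ring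
        rw [e2, hF t ht]
        ring
      rw [e, norm_mul, Complex.norm_real, Real.norm_of_nonneg (hb _)]
      refine mul_le_mul_of_nonneg_right ?_ (hb _)
      exact Real.norm_exp_I_mul_ofReal_sub_one_le.trans (hθ t ht)
    · have h0 : b (δ⁻¹ • (t - t₀)) = 0 := by
        apply hb1
        rw [norm_smul, norm_inv, Real.norm_of_nonneg hδ.le, ← div_eq_inv_mul, one_lt_div hδ]
        exact not_le.1 ht
      simp [hB, h0]
  have hle : 1 / 2 * ∫ t, B t ≤ ‖∫ v, ψ v * h v‖ := by
    rw [← heq]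
    have h1 : ‖(∫ t, ζ * (schwartzFourier m ψ t * F t)) - ∫ t, (B t : ℂ)‖ ≤ ∫ t, 1 / 2 * B t := by
      have hBc : Integrable (fun t => (B t : ℂ)) := hBint.ofReal
      rw [← integral_sub (hint.const_mul ζ) hBc]
      exact norm_integral_le_of_norm_le (hBint.const_mul _) (Eventually.of_forall hpt)
    have hB0 : 0 ≤ ∫ t, B t := integral_nonneg fun t => hb _
    have h2 : ‖∫ t, (B t : ℂ)‖ = ∫ t, B t := by
      rw [integral_complex_ofReal, Complex.norm_real, Real.norm_of_nonneg hB0]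
    have h3 : ‖∫ t, ζ * (schwartzFourier m ψ t * F t)‖ = ‖∫ t, schwartzFourier m ψ t * F t‖ := by
      rw [integral_const_mul, norm_mul, hζ, Complex.norm_exp_I_mul_ofReal, one_mul]
    have h4 := norm_sub_norm_le (∫ t, (B t : ℂ)) (∫ t, ζ * (schwartzFourier m ψ t * F t))
    rw [norm_sub_rev, h2, h3] at h4
    rw [integral_const_mul (1 / 2) B] at h1
    linarith
  calc ENNReal.ofReal (δ ^ m * ((1 / 2) * ∫ t, b t))
      ≤ ENNReal.ofReal ‖∫ v, ψ v * h v‖ := by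
        refine ENNReal.ofReal_le_ofReal (le_trans (le_of_eq ?_) hle)
        rw [hBval]; ring
    _ = ‖∫ v, ψ v * h v‖ₑ := ofReal_norm _
    _ ≤ ∫⁻ v, ‖ψ v * h v‖ₑ := enorm_integral_le_lintegral_enorm _
    _ = _ := by
        refine lintegral_congr fun v => ?_
        rw [enorm_mul, ← hnorm, enorm_norm]

theorem lintegral_enorm_pow_mul_norm_comp_smul {m : ℕ} (K : 𝓢(Rm m, ℂ)) {δ : ℝ} (hδ : 0 < δ) :
    ∫⁻ w, ‖δ ^ m * ‖K (δ • w)‖‖ₑ = ENNReal.ofReal (∫ w, ‖K w‖) := by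
  have hint : Integrable (fun w : Rm m => δ ^ m * ‖K (δ • w)‖) :=
    ((K.integrable (μ := volume)).norm.comp_smul hδ.ne').const_mul _
  rw [← ofReal_integral_norm_eq_lintegral_enorm hint]
  congr 1
  have : ∀ w : Rm m, ‖δ ^ m * ‖K (δ • w)‖‖ = δ ^ m * ‖K (δ • w)‖ :=
    fun w => Real.norm_of_nonneg (by positivity)
  simp_rw [this]
  rw [integral_const_mul, Measure.integral_comp_smul volume (fun w : Rm m => ‖K w‖),
    finrank_euclideanSpace, Fintype.card_fin, abs_of_pos (by positivity), smul_eq_mul,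
    ← mul_assoc, mul_inv_cancel₀ (by positivity), one_mul]

theorem exists_schwartz_bump (m : ℕ) : ∃ (b : Rm m → ℝ) (η : 𝓢(Rm m, ℂ)),
    (∀ t, 0 ≤ b t) ∧ (∀ t, 1 < ‖t‖ → b t = 0) ∧ 0 < ∫ t, b t ∧ HasCompactSupport η ∧
      ∀ t, η t = b t := by
  let b : ContDiffBump (0 : Rm m) := ⟨1 / 2, 1, by norm_num, by norm_num⟩
  have hcomp : HasCompactSupport (fun t => (b t : ℂ)) :=
    b.hasCompactSupport.comp_left (g := fun x : ℝ => (x : ℂ)) Complex.ofReal_zero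
  have hsmooth : ContDiff ℝ (⊤ : ℕ∞) (fun t => (b t : ℂ)) :=
    Complex.ofRealCLM.contDiff.comp b.contDiff
  exact ⟨b, hcomp.toSchwartzMap hsmooth, fun t => b.nonneg,
    fun t ht => b.zero_of_le_dist (by simpa using ht.le), b.integral_pos, hcomp, fun t => rfl⟩

theorem lintegral_enorm_hat_rpow {m : ℕ} {p : ℝ} (hp : 0 < p) {F : Rm m → ℂ}
    (hmem : MemLp (hat F) (ENNReal.ofReal p) volume) :
    ∫⁻ u, ‖hat F u‖ₑ ^ p = ENNReal.ofReal (∫ u, ‖hat F u‖ ^ p) := by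
  have hpp : Integrable (fun u => ‖hat F u‖ ^ p) := by
    have := hmem.integrable_norm_rpow (by simpa using hp) ENNReal.ofReal_ne_top
    rwa [ENNReal.toReal_ofReal hp.le] at this
  rw [ofReal_integral_eq_lintegral_ofReal hpp (Eventually.of_forall fun u => by positivity)]
  refine lintegral_congr fun u => ?_
  rw [← ENNReal.ofReal_rpow_of_nonneg (norm_nonneg _) hp.le, ofReal_norm]

/-- `S` is a set of frequencies at which `F` resembles a plane wave on some ball of radius `δ`. The
constant is uniform in `δ` because dilating the packet preserves its `L¹` norm. -/
theorem exists_le_apNorm (m : ℕ) {p : ℝ} (hp : 1 ≤ p) :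
    ∃ κ : ℝ, 0 < κ ∧ ∀ F ∈ Ap m p, ∀ (S : Set (Rm m)) (δ a : ℝ), 0 < δ → 0 ≤ a →
      ENNReal.ofReal a ≤ volume S →
      (∀ u ∈ S, ∃ (t₀ : Rm m) (θ : Rm m → ℝ), ∀ t, ‖t - t₀‖ ≤ δ →
        F t = Complex.exp (Complex.I * (θ t : ℝ)) ∧
        |θ t - θ t₀ - inner ℝ u (t - t₀)| ≤ 1 / 2) →
      κ * δ ^ m * a ^ (1 / p) ≤ apNorm p F := by
  have hp0 : 0 < p := by linarith
  obtain ⟨b, η, hb, hb1, hJ, hη, hbη⟩ := exists_schwartz_bump m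
  set J := 1 / 2 * ∫ t, b t with hJdef
  have hJ0 : 0 < J := by positivity
  set K := schwartzFourierInv m η with hK
  set A := ∫ w, ‖K w‖ with hA
  have hA0 : 0 ≤ A := integral_nonneg fun w => norm_nonneg _
  -- `A + 1` in place of `A` makes it unnecessary to check `A ≠ 0`.
  refine ⟨J / (A + 1), by positivity, fun F hF S δ a hδ ha haS hS => ?_⟩
  obtain ⟨hex, hmem, -⟩ := hF
  have H := hasFourierFunction_hat hex
  have hconv := rpow_mul_measure_le_of_le_lintegral hp
    (k := fun w => ‖δ ^ m * ‖K (δ • w)‖‖ₑ)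
    (by
      have : Continuous fun w : Rm m => δ ^ m * ‖K (δ • w)‖ :=
        continuous_const.mul (K.continuous.comp (continuous_const_smul δ)).norm
      exact this.enorm.measurable)
    hmem.aestronglyMeasurable (S := S) (a := ENNReal.ofReal (δ ^ m * J))
    (by
      intro u hu
      obtain ⟨t₀, θ, h⟩ := hS u hu
      exact H.le_lintegral hb hb1 hη hbη hδ
        (fun t ht => (h t ht).1) (fun t ht => (h t ht).2))
  rw [lintegral_enorm_pow_mul_norm_comp_smul K hδ] at hconv
  have hN0 : 0 ≤ ∫ u, ‖hat F u‖ ^ p := integral_nonneg fun u => by positivity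
  have hchain : ENNReal.ofReal ((δ ^ m * J) ^ p * a) ≤
      ENNReal.ofReal (A ^ p * ∫ u, ‖hat F u‖ ^ p) := by
    rw [ENNReal.ofReal_mul (by positivity), ENNReal.ofReal_mul (by positivity),
      ← ENNReal.ofReal_rpow_of_nonneg (by positivity) hp0.le,
      ← ENNReal.ofReal_rpow_of_nonneg hA0 hp0.le, ← lintegral_enorm_hat_rpow hp0 hmem]
    exact (mul_le_mul_right haS _).trans hconv
  have hreal := (ENNReal.ofReal_le_ofReal_iff (by positivity)).1 hchain
  have hroot := Real.rpow_le_rpow (by positivity) hreal (z := 1 / p) (by positivity)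
  rw [Real.mul_rpow (by positivity) ha, Real.mul_rpow (by positivity) hN0,
    ← Real.rpow_mul (by positivity), ← Real.rpow_mul hA0, mul_one_div_cancel hp0.ne',
    Real.rpow_one, Real.rpow_one] at hroot
  have hap : 0 ≤ apNorm p F := Real.rpow_nonneg hN0 _
  have hroot' : δ ^ m * J * a ^ (1 / p) ≤ A * apNorm p F := hroot
  have e : J / (A + 1) * δ ^ m * a ^ (1 / p) = δ ^ m * J * a ^ (1 / p) / (A + 1) := by ring
  rw [e, div_le_iff₀ (by positivity)]
  nlinarith


/-! ### Choice of the scale and conclusion -/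

/-- A set of positive gradient measure has a part of positive gradient measure at a positive
distance from the complement of the domain. -/
theorem exists_closedBall_subset_volume_image_pos {m : ℕ} {V : Set (Rm m)} (hV : IsOpen V)
    {f : Rm m → Rm m} (hpos : 0 < volume (f '' V)) :
    ∃ r : ℝ, 0 < r ∧ 0 < volume (f '' {t | Metric.closedBall t r ⊆ V}) := by
  by_contra! hcon
  have hsub : f '' V ⊆ ⋃ n : ℕ, f '' {t | Metric.closedBall t (1 / ((n : ℝ) + 1)) ⊆ V} := by
    rintro _ ⟨t, ht, rfl⟩
    obtain ⟨ε, hε, hball⟩ := Metric.isOpen_iff.1 hV t ht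
    obtain ⟨n, hn⟩ := exists_nat_one_div_lt hε
    exact mem_iUnion.2 ⟨n, t, (Metric.closedBall_subset_ball hn).trans hball, rfl⟩
  refine hpos.ne' (measure_mono_null hsub (measure_iUnion_null fun n => ?_))
  exact nonpos_iff_eq_zero.1 (hcon _ (by positivity))

open scoped Pointwise in
theorem exists_le_apNormOn {m : ℕ} {p : ℝ} (hp1 : 1 ≤ p) {ω : ℝ → ℝ}
    (hω_mono : MonotoneOn ω (Ici 0)) (hω_zero : ω 0 = 0)
    (hbij : BijOn (chi ω) (Ici 0) (Ici 0)) (hstrict : StrictMonoOn (chi ω) (Ici 0))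
    {V : Set (Rm m)} (hV_open : IsOpen V) {φ : Rm m → ℝ} (hφ : C1Omega ω V φ)
    (hgrad : 0 < volume (grad φ '' V)) :
    ∃ c : ℝ, 0 < c ∧ ∀ lam : ℝ, 1 ≤ |lam| →
      (fun t => Complex.exp (Complex.I * (lam * φ t : ℝ))) ∈ ApOn p V →
      c * (|lam| ^ (1 / p) * chiInv ω (1 / |lam|)) ^ m ≤
        apNormOn p V (fun t => Complex.exp (Complex.I * (lam * φ t : ℝ))) := by
  have hω : ∀ δ, 0 ≤ δ → 0 ≤ ω δ := fun δ hδ => hω_zero ▸ hω_mono (mem_Ici.2 le_rfl) hδ hδ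
  obtain ⟨C, hC, δ₀, hδ₀, hosc⟩ := hφ.exists_abs_sub_le hω
  obtain ⟨r, hr, hVr⟩ := exists_closedBall_subset_volume_image_pos hV_open hgrad
  obtain ⟨κ, hκ, hlow⟩ := exists_le_apNorm m hp1
  set G := grad φ '' {t | Metric.closedBall t r ⊆ V} with hG
  -- The measure of `G` may be infinite, hence a finite positive minorant.
  obtain ⟨a, ha, haG⟩ : ∃ a : ℝ, 0 < a ∧ ENNReal.ofReal a ≤ volume G := by
    obtain ⟨q, hq, hqG⟩ := ENNReal.lt_iff_exists_nnreal_btwn.1 hVr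
    exact ⟨q, by exact_mod_cast hq, by simpa using hqG.le⟩
  have hinv : ∀ y, 0 ≤ y → 0 ≤ chiInv ω y ∧ chi ω (chiInv ω y) = y := fun y hy =>
    ⟨hbij.surjOn.mapsTo_invFunOn hy, hbij.invOn_invFunOn.2 hy⟩
  set X := chiInv ω 1 with hX
  have hX0 : 0 ≤ X := (hinv 1 zero_le_one).1
  -- As `|λ| ≥ 1`, `X` bounds every `χ⁻¹(1/|λ|)`. Thus `δ = s χ⁻¹(1/|λ|)` is within the range `δ₀`
  -- of the Lipschitz estimate and fits the margin `r`; `s ≤ 1` allows `ω(δ) ≤ ω(χ⁻¹(1/|λ|))`, and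
  -- the last condition bounds the phase error.
  obtain ⟨s, hs, hs1, hsδ, hsr, hsC⟩ : ∃ s : ℝ, 0 < s ∧ s ≤ 1 ∧ s * X ≤ δ₀ ∧ s * X ≤ r ∧
      s * (m * C) ≤ 1 / 2 := by
    have h : ∀ b ε : ℝ, 0 < ε → ∀ᶠ s in 𝓝[>] (0 : ℝ), s * b ≤ ε := fun b ε hε => by
      have : Tendsto (fun s : ℝ => s * b) (𝓝[>] 0) (𝓝 (0 * b)) :=
        (tendsto_id.mono_left nhdsWithin_le_nhds).mul_const b
      rw [zero_mul] at this
      exact this.eventually_le_const hε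
    obtain ⟨s, h1, h2, h3, h4, h5⟩ := (eventually_mem_nhdsWithin.and ((h 1 1 one_pos).and
      ((h X δ₀ hδ₀).and ((h X r hr).and (h (m * C) (1 / 2) (by norm_num)))))).exists
    exact ⟨s, h1, by simpa using h2, h3, h4, h5⟩
  refine ⟨κ * s ^ m * a ^ (1 / p), by positivity, fun lam hlam hmem => ?_⟩
  have hl0 : 0 < |lam| := by linarith
  set x := chiInv ω (1 / |lam|) with hx
  obtain ⟨hx0, hxchi⟩ := hinv (1 / |lam|) (by positivity)
  rw [← hx] at hx0 hxchi
  have hxpos : 0 < x := by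
    refine lt_of_le_of_ne hx0 fun h => ?_
    rw [← h, chi, zero_mul] at hxchi
    have : 0 < 1 / |lam| := by positivity
    linarith
  have hxX : x ≤ X := by
    refine (hstrict.le_iff_le hx0 hX0).1 ?_
    rw [hxchi, (hinv 1 zero_le_one).2]
    exact (div_le_one hl0).2 hlam
  set δ := s * x with hδdef
  have hδ : 0 < δ := mul_pos hs hxpos
  have hδX : δ ≤ s * X := mul_le_mul_of_nonneg_left hxX hs.le
  have hδx : δ ≤ x := mul_le_of_le_one_left hx0 hs1
  have hphase : |lam| * (m * (C * ω δ * δ)) ≤ 1 / 2 := by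
    have h1 : ω δ ≤ ω x := hω_mono hδ.le hx0 hδx
    have h2 : |lam| * (x * ω x) = 1 := by
      change |lam| * chi ω x = 1
      rw [hxchi]; field_simp
    calc |lam| * (m * (C * ω δ * δ)) ≤ |lam| * (m * (C * ω x * δ)) := by gcongr
      _ = s * (m * C) * (|lam| * (x * ω x)) := by rw [hδdef]; ring
      _ ≤ 1 / 2 := by rw [h2, mul_one]; exact hsC
  -- Membership in `ApOn` makes the set of norms nonempty; the real infimum of the empty set would
  -- be `0`.
  refine le_csInf ?_ ?_
  · obtain ⟨F, hF, hFE⟩ := hmem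
    exact ⟨_, F, ⟨hF, hFE⟩, rfl⟩
  rintro _ ⟨F, ⟨hF, hFE⟩, rfl⟩
  have hvol : ENNReal.ofReal (|lam| ^ m * a) ≤ volume (lam • G) := by
    rw [Measure.addHaar_smul, finrank_euclideanSpace, Fintype.card_fin, abs_pow,
      ENNReal.ofReal_mul (by positivity)]
    gcongr
  have key := hlow F hF (lam • G) δ (|lam| ^ m * a) hδ (by positivity) hvol (by
    rintro _ ⟨_, ⟨t₀, ht₀, rfl⟩, rfl⟩
    have hball : ∀ x, ‖x - t₀‖ ≤ δ → x ∈ V := fun x hx =>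
      ht₀ (by rw [Metric.mem_closedBall, dist_eq_norm]; linarith)
    have ht₀V : t₀ ∈ V := hball t₀ (by simpa using hδ.le)
    refine ⟨t₀, fun t => lam * φ t, fun t ht => ⟨hFE (hball t ht), ?_⟩⟩
    have htay := abs_sub_sub_inner_grad_le (φ := φ) (t₀ := t₀) (δ := δ) (K := C * ω δ)
      (fun j x hx => (hφ j).1 x (hball x hx))
      (fun j x hx => hosc δ hδ (hδX.trans hsδ) j x (hball x hx) t₀ ht₀V hx) ht
    have e : lam * φ t - lam * φ t₀ - inner ℝ (lam • grad φ t₀) (t - t₀) =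
        lam * (φ t - φ t₀ - inner ℝ (grad φ t₀) (t - t₀)) := by
      rw [real_inner_smul_left]; ring
    change |lam * φ t - lam * φ t₀ - inner ℝ (lam • grad φ t₀) (t - t₀)| ≤ 1 / 2
    rw [e, abs_mul]
    exact (mul_le_mul_of_nonneg_left htay hl0.le).trans hphase)
  refine le_trans (le_of_eq ?_) key
  have e : (|lam| ^ m) ^ (1 / p) = (|lam| ^ (1 / p)) ^ m := by
    rw [← Real.rpow_natCast, ← Real.rpow_natCast, ← Real.rpow_mul hl0.le, ← Real.rpow_mul hl0.le,
      mul_comm]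
  rw [Real.mul_rpow (by positivity) ha.le, e, hδdef]
  ring

end BeurlingHelson


theorem theorem1 (m : ℕ) (hm : 1 ≤ m) (p : ℝ) (hp1 : 1 ≤ p) (hp2 : p < 2)
    (ω : ℝ → ℝ) (hω_cont : ContinuousOn ω (Set.Ici 0)) (hω_mono : MonotoneOn ω (Set.Ici 0))
    (hω_zero : ω 0 = 0)
    (V : Set (BeurlingHelson.Rm m)) (hV_open : IsOpen V) (hV_conn : IsConnected V)
    (φ : BeurlingHelson.Rm m → ℝ) (hφ : BeurlingHelson.C1Omega ω V φ)
    (hgrad : 0 < MeasureTheory.volume (BeurlingHelson.grad φ '' V)) :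
    Set.BijOn (BeurlingHelson.chi ω) (Set.Ici 0) (Set.Ici 0) ∧
    ∃ c : ℝ, 0 < c ∧ ∀ lam : ℝ, 1 ≤ |lam| →
      (fun t => Complex.exp (Complex.I * (lam * φ t : ℝ))) ∈ BeurlingHelson.ApOn p V →
      c * (|lam| ^ (1 / p) * BeurlingHelson.chiInv ω (1 / |lam|)) ^ m ≤
        BeurlingHelson.apNormOn p V (fun t => Complex.exp (Complex.I * (lam * φ t : ℝ))) := by
  have hω_pos : ∀ δ, 0 < δ → 0 < ω δ := fun δ hδ =>
    lt_of_le_of_ne (hω_zero ▸ hω_mono (Set.mem_Ici.2 le_rfl) hδ.le hδ.le) fun h =>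
      hgrad.ne' (hφ.volume_image_grad_eq_zero hm hω_mono hω_zero hV_conn hδ h.symm)
  obtain ⟨hbij, hstrict⟩ := BeurlingHelson.bijOn_chi hω_cont hω_mono hω_zero hω_pos
  exact ⟨hbij, BeurlingHelson.exists_le_apNormOn hp1 hω_mono hω_zero hbij hstrict hV_open hφ hgrad⟩
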